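/- Let $0\le\alpha\le\pi$. A treasure and an exit lie at unknown points of the boundary of the closed unit disk, at known arc distance $\alpha$ (the length of the shorter arc between them). Two robots start at the center of the disk at time $0$, share a clock and a coordinate system, and move in the disk with speed at most $1$, independently of each other. A robot detects the treasure or the exit only when it is exactly at that point. A robot that is at the treasure may pick it up, carry it, drop it, or hand it over; otherwise the treasure is at rest. In the face-to-face problem 2-TE$_{f2f}$ the robots can exchange information only when they are at the same point. A (deterministic) algorithm prescribes how the robots move and handle the treasure, where the actions of each robot at any time depend only on what it has itself observed, and on what the other robot has told it at meetings, up to that time. The evacuation time of a placement of treasure and exit is the first time at which a robot is at the exit with the treasure ($+\infty$ if this never happens), and the time that the algorithm needs is the supremum of its evacuation times over all placements at arc distance $\alpha$. **Theorem (face-to-face lower bound).** Every algorithm for 2-TE$_{f2f}$ needs time at least $$1+\frac{\pi}{3}+4\sin\frac{\alpha}{2}\quad\text{if } 0\le\alpha\le\frac{2\pi}{3},$$ and at least $$1+\frac{\pi}{3}+2\sin\alpha+2\sin\frac{\alpha}{2}\quad\text{if } \frac{2\pi}{3}\le\alpha\le\pi .$$ -/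

import Mathlib

open scoped NNReal ENNReal

namespace TreasureEvacuation

/-- A placement of the treasure and of the exit on the perimeter of the unit disk of the plane `ℂ`,
at arc distance `α` from each other. For two points of the unit circle the (unoriented) angle is
the length of the shorter arc between them. -/
structure Placement (α : ℝ) where
  treasure : ℂ
  exit : ℂ
  norm_treasure : ‖treasure‖ = 1
  norm_exit : ‖exit‖ = 1
  arc : InnerProductGeometry.angle treasure exit = α

/-- The things that move: the two robots and the treasure. -/
inductive Body where
  | robot (i : Fin 2)
  | treasure

/-- What the robots do with each placement: the trajectories of the two robots and the trajectory
of the treasure, for all times `t ≥ 0`. -/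
structure Behaviour (α : ℝ) where
  robot : Placement α → Fin 2 → ℝ≥0 → ℂ
  treasure : Placement α → ℝ≥0 → ℂ

/-- The flow of information in the face-to-face model, for two placements `P` and `Q`.

`Differs B P Q (.robot i) t`: what robot `i` has seen and has been told up to time `t` (inclusive)
is not the same under `P` as under `Q`. A robot sees a point only when it is exactly there, and it
is told something only when it is at the same point as the other robot, in which case it learns all
that the other robot knows.

`Differs B P Q .treasure t`: there is a cause for the treasure not to be at the same point at time
`t` under `P` and under `Q`; either it was hidden at two different points, or it was handled by
a robot whose information differs.

The predicate is the least one with these closure properties, so every difference goes back, by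
finitely many steps, to a robot that passed over the exit or over the treasure. In particular
a robot never gains information by its own decisions. -/
inductive Differs {α : ℝ} (B : Behaviour α) (P Q : Placement α) : Body → ℝ≥0 → Prop
  /-- Robot `i` is at the exit under one placement; under the other one the exit is elsewhere. -/
  | seeExit (i : Fin 2) (t : ℝ≥0) :
      P.exit ≠ Q.exit → (B.robot P i t = P.exit ∨ B.robot Q i t = Q.exit) →
      Differs B P Q (.robot i) t
  /-- Robot `i` is at the treasure under one placement; under the other one the treasure is
  elsewhere at that time. -/
  | seeTreasure (i : Fin 2) (t : ℝ≥0) :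
      Differs B P Q .treasure t → B.treasure P t ≠ B.treasure Q t →
      (B.robot P i t = B.treasure P t ∨ B.robot Q i t = B.treasure Q t) →
      Differs B P Q (.robot i) t
  /-- Robot `i` meets robot `j`, whose information differs. -/
  | meet (i j : Fin 2) (t : ℝ≥0) :
      Differs B P Q (.robot j) t →
      (B.robot P i t = B.robot P j t ∨ B.robot Q i t = B.robot Q j t) →
      Differs B P Q (.robot i) t
  /-- Robots do not forget. -/
  | remember (i : Fin 2) (s t : ℝ≥0) :
      s ≤ t → Differs B P Q (.robot i) s → Differs B P Q (.robot i) t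
  /-- The treasure is hidden at two different points. -/
  | hidden : P.treasure ≠ Q.treasure → Differs B P Q .treasure 0
  /-- A robot whose information differs is at the treasure: it may pick up, keep or drop it. -/
  | handle (i : Fin 2) (t : ℝ≥0) :
      Differs B P Q (.robot i) t →
      (B.robot P i t = B.treasure P t ∨ B.robot Q i t = B.treasure Q t) →
      Differs B P Q .treasure t
  /-- The effect lasts as long as the two positions of the treasure stay apart; the treasure
  has no other memory. -/
  | apart (s t : ℝ≥0) :
      s ≤ t → (∀ u, s < u → u ≤ t → B.treasure P u ≠ B.treasure Q u) →
      Differs B P Q .treasure s → Differs B P Q .treasure t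

/-- A (deterministic) algorithm for two robots in the face-to-face model that know the arc distance
`α` of treasure and exit but not their positions. The robots share a clock and a coordinate
system, may follow different rules, and may pick up, drop and hand over the treasure. -/
structure F2FAlgorithm (α : ℝ) extends Behaviour α where
  /-- The robots start at the center. -/
  robot_zero : ∀ P i, robot P i 0 = 0
  /-- The robots stay in the unit disk. -/
  robot_mem : ∀ P i t, ‖robot P i t‖ ≤ 1
  /-- The robots have maximum speed `1`. -/
  robot_speed : ∀ P i, LipschitzWith 1 (robot P i)
  /-- The treasure starts where it is hidden. -/
  treasure_zero : ∀ P, treasure P 0 = P.treasure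
  /-- The treasure does not move faster than the robots. -/
  treasure_speed : ∀ P, LipschitzWith 1 (treasure P)
  /-- The treasure is at rest as long as no robot is with it. -/
  treasure_rest : ∀ P (s t : ℝ≥0), s ≤ t →
    (∀ u, s ≤ u → u ≤ t → ∀ i, robot P i u ≠ treasure P u) → treasure P s = treasure P t
  /-- The motion of a robot depends only on the information that it has. -/
  robot_causal : ∀ P Q i t, ¬ Differs toBehaviour P Q (.robot i) t → robot P i t = robot Q i t
  /-- So does what the robots do with the treasure. -/
  treasure_causal : ∀ P Q t, ¬ Differs toBehaviour P Q .treasure t → treasure P t = treasure Q t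

namespace F2FAlgorithm

variable {α : ℝ}

/-- At time `t` the treasure is at the exit, together with a robot. (The robot matters only if
treasure and exit are at the same point from the start: the treasure still has to be found.) -/
def Evacuated (A : F2FAlgorithm α) (P : Placement α) (t : ℝ≥0) : Prop :=
  A.treasure P t = P.exit ∧ ∃ i, A.robot P i t = P.exit

/-- The evacuation time for the placement `P` (`⊤` if the treasure is never brought to the
exit). -/
noncomputable def evacuationTime (A : F2FAlgorithm α) (P : Placement α) : ℝ≥0∞ :=
  ⨅ (t : ℝ≥0) (_ : A.Evacuated P t), (t : ℝ≥0∞)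

/-- The time that the algorithm needs: the supremum of its evacuation times over all placements. -/
noncomputable def worstCaseTime (A : F2FAlgorithm α) : ℝ≥0∞ :=
  ⨆ P : Placement α, A.evacuationTime P

end F2FAlgorithm

end TreasureEvacuation

/-!
Before time `1 + π / 3` the two robots have together visited less than a third of the unit circle,
so there are three points at successive arc distance `α` that no robot has visited. Place treasure
and exit at these points. Any difference between two such runs starts at one of the points and
is carried along by bodies of speed at most `1`, so it stays inside the light cones of the points.
Let each of the three points be the treasure's hiding place in one run. Two of the three treasures
are found by the same robot; at the later of the two visits a signal sent at time `1 + π / 3` can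
have travelled from one of the points to another one, over a distance of at least
`2 * min (sin (α / 2)) (sin α)`. In that run the treasure still has to be carried over a chord of
length `2 * sin (α / 2)`.

Unvisited points are found by measuring subsets of the circle with the one-dimensional Hausdorff
measure, which does not increase under `1`-Lipschitz maps. A robot needs one time unit to reach the
circle and so has visited at most length `t - 1` of it by time `t`.
-/

namespace TreasureEvacuation

open MeasureTheory Measure Set Filter Real
open scoped Topology

/-! ### Length of arcs of the unit circle -/

instance : IsIsometricSMul Circle ℂ :=
  ⟨fun g ↦ Isometry.of_dist_eq fun x y ↦ by
    rw [dist_eq_norm, ← smul_sub, Circle.norm_smul, dist_eq_norm]⟩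

/-- The arc of the unit circle from angle `a` (included) to angle `b` (excluded); being half-open,
adjacent arcs are disjoint. -/
def circleArc (a b : ℝ) : Set ℂ := (fun x : ℝ ↦ (Circle.exp x : ℂ)) '' Ico a b

lemma hausdorffMeasure_image_Icc_le {E : Type*} [EMetricSpace E] [MeasurableSpace E] [BorelSpace E]
    {f : ℝ → E} (hf : LipschitzWith 1 f) (a b : ℝ) :
    μH[1] (f '' Icc a b) ≤ ENNReal.ofReal (b - a) := by
  simpa [hausdorffMeasure_real] using hf.hausdorffMeasure_image_le zero_le_one (Icc a b)

lemma circleArc_union_circleArc {a b c : ℝ} (hab : a ≤ b) (hbc : b ≤ c) :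
    circleArc a b ∪ circleArc b c = circleArc a c := by
  rw [circleArc, circleArc, circleArc, ← image_union, Ico_union_Ico_eq_Ico hab hbc]

lemma image_smul_circleArc (θ a b : ℝ) :
    (Circle.exp θ • ·) '' circleArc a b = circleArc (θ + a) (θ + b) := by
  simp only [circleArc, ← image_const_add_Ico, image_image, Circle.smul_def, Circle.exp_add,
    Circle.coe_mul, smul_eq_mul]

lemma injOn_coe_circleExp_Ico {a b : ℝ} (h : b - a ≤ 2 * π) :
    InjOn (fun x : ℝ ↦ (Circle.exp x : ℂ)) (Ico a b) :=
  Circle.coe_injective.injOn.comp (Circle.exp_injOn_Ico h) (mapsTo_univ _ _)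

lemma disjoint_circleArc {a b c : ℝ} (hab : a ≤ b) (hbc : b ≤ c) (hac : c - a ≤ 2 * π) :
    Disjoint (circleArc a b) (circleArc b c) := by
  rw [circleArc, circleArc, disjoint_iff_inter_eq_empty,
    ← (injOn_coe_circleExp_Ico hac).image_inter (Ico_subset_Ico_right hbc)
      (Ico_subset_Ico_left hab), (Ico_disjoint_Ico_same).inter_eq, image_empty]

lemma measurableSet_circleArc {a b : ℝ} (h : b - a ≤ 2 * π) : MeasurableSet (circleArc a b) :=
  measurableSet_Ico.image_of_continuousOn_injOn
    (continuous_subtype_val.comp Circle.exp.continuous).continuousOn (injOn_coe_circleExp_Ico h)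

lemma hausdorffMeasure_circleArc_two_mul {θ : ℝ} (h0 : 0 ≤ θ) (h : 2 * θ ≤ 2 * π) :
    μH[1] (circleArc 0 (2 * θ)) = 2 * μH[1] (circleArc 0 θ) := by
  have hrot : circleArc θ (2 * θ) = (Circle.exp θ • ·) '' circleArc 0 θ := by
    rw [image_smul_circleArc, add_zero, two_mul]
  have hle : θ ≤ 2 * θ := by linarith
  rw [← circleArc_union_circleArc h0 hle, measure_union (disjoint_circleArc h0 hle (by linarith))
    (measurableSet_circleArc (by linarith)), hrot,
    (isometry_smul ℂ _).hausdorffMeasure_image (.inl zero_le_one), two_mul]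

lemma ofReal_sin_le_hausdorffMeasure_circleArc {θ : ℝ} (hθ : 0 ≤ θ) :
    ENNReal.ofReal (sin θ) ≤ μH[1] (circleArc 0 θ) := by
  have hIm : LipschitzWith 1 Complex.im :=
    .of_dist_le_mul fun z w ↦ by
      simpa [dist_eq_norm] using Complex.abs_im_le_norm (z - w)
  have hsub : Ico 0 (sin θ) ⊆ Complex.im '' circleArc 0 θ := by
    have := intermediate_value_Ico hθ continuous_sin.continuousOn
    simpa [circleArc, image_image] using this
  calc ENNReal.ofReal (sin θ) = μH[1] (Ico 0 (sin θ)) := by simp [hausdorffMeasure_real]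
    _ ≤ μH[1] (Complex.im '' circleArc 0 θ) := measure_mono hsub
    _ ≤ μH[1] (circleArc 0 θ) := by
      simpa using hIm.hausdorffMeasure_image_le zero_le_one _

lemma two_pow_mul_sin_le_hausdorffMeasure_circleArc {θ : ℝ} (h0 : 0 ≤ θ) (h : θ ≤ 2 * π)
    (n : ℕ) : ENNReal.ofReal (2 ^ n * sin (θ / 2 ^ n)) ≤ μH[1] (circleArc 0 θ) := by
  induction n generalizing θ with
  | zero => simpa using ofReal_sin_le_hausdorffMeasure_circleArc h0
  | succ n ih =>
    have hhalf := hausdorffMeasure_circleArc_two_mul (θ := θ / 2) (by linarith) (by linarith)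
    rw [mul_div_cancel₀ _ two_ne_zero] at hhalf
    rw [hhalf, pow_succ', mul_assoc, ENNReal.ofReal_mul zero_le_two, ENNReal.ofReal_ofNat,
      ← div_div]
    gcongr
    exact ih (by linarith) (by linarith)

lemma tendsto_two_pow_mul_sin (θ : ℝ) :
    Tendsto (fun n : ℕ ↦ (2 : ℝ) ^ n * sin (θ / 2 ^ n)) atTop (𝓝 θ) := by
  have hlim : Tendsto (fun n : ℕ ↦ θ / 2 ^ n) atTop (𝓝 0) :=
    tendsto_const_nhds.div_atTop (tendsto_pow_atTop_atTop_of_one_lt one_lt_two)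
  have hsinc := ((continuous_sinc.tendsto 0).comp hlim).const_mul θ
  rw [sinc_zero, mul_one] at hsinc
  refine hsinc.congr fun n ↦ ?_
  rcases eq_or_ne θ 0 with rfl | hθ
  · simp
  · rw [Function.comp_apply, sinc_of_ne_zero (by positivity)]
    field_simp

lemma ofReal_le_hausdorffMeasure_circleArc {θ : ℝ} (h0 : 0 ≤ θ) (h : θ ≤ 2 * π) :
    ENNReal.ofReal θ ≤ μH[1] (circleArc 0 θ) :=
  le_of_tendsto (ENNReal.tendsto_ofReal (tendsto_two_pow_mul_sin θ)) <|
    .of_forall (two_pow_mul_sin_le_hausdorffMeasure_circleArc h0 h)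

lemma two_pi_le_hausdorffMeasure_sphere :
    ENNReal.ofReal (2 * π) ≤ μH[1] (Metric.sphere (0 : ℂ) 1) :=
  (ofReal_le_hausdorffMeasure_circleArc two_pi_pos.le le_rfl).trans <| measure_mono <| by
    rintro _ ⟨x, -, rfl⟩
    simp

lemma dist_circleExp_smul (x y : ℝ) (z : ℂ) :
    dist (Circle.exp x • z) (Circle.exp y • z) = 2 * |sin ((x - y) / 2)| * ‖z‖ := by
  have hrot : Circle.exp x • z = Circle.exp y • Circle.exp (x - y) • z := by
    rw [smul_smul, ← Circle.exp_add, add_sub_cancel]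
  rw [hrot, dist_smul, dist_eq_norm, Circle.smul_def, smul_eq_mul, ← sub_one_mul, norm_mul,
    Circle.coe_exp, mul_comm ((x - y : ℝ) : ℂ), Complex.norm_exp_I_mul_ofReal_sub_one]
  simp

lemma lipschitzWith_circleExp_smul {z : ℂ} (hz : ‖z‖ = 1) :
    LipschitzWith 1 fun θ : ℝ ↦ Circle.exp θ • z :=
  .of_dist_le_mul fun x y ↦ by
    have hsin := abs_sin_le_abs (x := (x - y) / 2)
    rw [abs_div, abs_two] at hsin
    rw [dist_circleExp_smul, hz, Real.dist_eq, NNReal.coe_one]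
    linarith

lemma exists_circleExp_smul_eq {z w : ℂ} (hz : ‖z‖ = 1) (hw : ‖w‖ = 1) :
    ∃ θ : ℝ, |θ| ≤ π / 2 * ‖w - z‖ ∧ Circle.exp θ • z = w := by
  have hz0 : z ≠ 0 := fun h ↦ by simp [h] at hz
  have hw0 : w ≠ 0 := fun h ↦ by simp [h] at hw
  refine ⟨(w / z).arg, ?_, ?_⟩
  · rw [← Complex.angle_eq_abs_arg hw0 hz0]
    exact Complex.angle_le_mul_norm_sub hw hz
  · have hwz := Complex.norm_mul_exp_arg_mul_I (w / z)
    rw [norm_div, hz, hw, div_one, Complex.ofReal_one, one_mul] at hwz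
    rw [Circle.smul_def, Circle.coe_exp, hwz, smul_eq_mul, div_mul_cancel₀ w hz0]

lemma hausdorffMeasure_sphere_inter_closedBall_le (p : ℂ) (r : ℝ) :
    μH[1] (Metric.sphere (0 : ℂ) 1 ∩ Metric.closedBall p r) ≤ ENNReal.ofReal (2 * π * r) := by
  rcases eq_empty_or_nonempty (Metric.sphere (0 : ℂ) 1 ∩ Metric.closedBall p r) with
    h | ⟨z, hz, hzr⟩
  · simp [h]
  rw [mem_sphere_zero_iff_norm] at hz
  have hsub : Metric.sphere (0 : ℂ) 1 ∩ Metric.closedBall p r ⊆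
      (fun θ : ℝ ↦ Circle.exp θ • z) '' Icc (-(π * r)) (π * r) := by
    rintro w ⟨hw, hwr⟩
    obtain ⟨θ, hθ, hθw⟩ := exists_circleExp_smul_eq hz (mem_sphere_zero_iff_norm.1 hw)
    have hdist : ‖w - z‖ ≤ 2 * r := by
      rw [← dist_eq_norm]
      linarith [dist_triangle_right w z p, Metric.mem_closedBall.1 hwr, Metric.mem_closedBall.1 hzr]
    refine ⟨θ, abs_le.1 (hθ.trans ?_), hθw⟩
    nlinarith [pi_pos]
  calc _ ≤ μH[1] ((fun θ : ℝ ↦ Circle.exp θ • z) '' Icc (-(π * r)) (π * r)) := measure_mono hsub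
    _ ≤ ENNReal.ofReal (π * r - -(π * r)) :=
      hausdorffMeasure_image_Icc_le (lipschitzWith_circleExp_smul hz) _ _
    _ = ENNReal.ofReal (2 * π * r) := by ring_nf

/-! ### The part of the circle that a curve explores -/

lemma dist_le_sub {E : Type*} [PseudoMetricSpace E] {γ : ℝ≥0 → E} (hγ : LipschitzWith 1 γ)
    {s t : ℝ≥0} (hst : s ≤ t) : dist (γ t) (γ s) ≤ t - s := by
  have hts : (0 : ℝ) ≤ t - s := sub_nonneg.2 hst
  simpa [NNReal.dist_eq, abs_of_nonneg hts] using hγ.dist_le_mul t s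

lemma hausdorffMeasure_sphere_inter_image_Iic_le {E : Type*} [NormedAddCommGroup E]
    [MeasurableSpace E] [BorelSpace E] {γ : ℝ≥0 → E} (hγ : LipschitzWith 1 γ) (h0 : γ 0 = 0)
    (t : ℝ≥0) :
    μH[1] (Metric.sphere 0 1 ∩ γ '' Iic t) ≤ ENNReal.ofReal (t - 1) := by
  have hsub : Metric.sphere 0 1 ∩ γ '' Iic t ⊆ (fun s : ℝ ↦ γ s.toNNReal) '' Icc 1 t := by
    rintro _ ⟨hs1, s, hst, rfl⟩
    have hs := dist_le_sub hγ (zero_le (a := s))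
    rw [h0, Metric.mem_sphere.1 hs1] at hs
    exact ⟨s, ⟨by simpa using hs, by exact_mod_cast hst⟩, by simp⟩
  have hγ' : LipschitzWith 1 fun s : ℝ ↦ γ s.toNNReal := by
    simpa [Function.comp_def] using hγ.comp lipschitzWith_toNNReal
  exact (measure_mono hsub).trans (hausdorffMeasure_image_Icc_le hγ' 1 t)

/-- The points visited by the curve `γ` up to time `t`, together with those within distance `r` of
its position at time `t`: no other point can be reached up to time `t + r` at unit speed. -/
def explored {E : Type*} [PseudoMetricSpace E] (γ : ℝ≥0 → E) (t : ℝ≥0) (r : ℝ) : Set E :=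
  γ '' Iic t ∪ Metric.closedBall (γ t) r

lemma hausdorffMeasure_sphere_inter_explored_le {γ : ℝ≥0 → ℂ} (hγ : LipschitzWith 1 γ)
    (h0 : γ 0 = 0) (t : ℝ≥0) {r : ℝ} (hr : 0 ≤ r) :
    μH[1] (Metric.sphere 0 1 ∩ explored γ t r) ≤
      ENNReal.ofReal (max ((t : ℝ) - 1) 0 + 2 * π * r) := by
  rw [explored, inter_union_distrib_left, ENNReal.ofReal_add (le_max_right _ _) (by positivity)]
  refine (measure_union_le _ _).trans (add_le_add ?_ ?_)
  · exact (hausdorffMeasure_sphere_inter_image_Iic_le hγ h0 t).trans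
      (ENNReal.ofReal_le_ofReal (le_max_left _ _))
  · exact hausdorffMeasure_sphere_inter_closedBall_le (γ t) r

lemma exists_mem_forall_smul_notMem {G X : Type*} [Group G] [MulAction G X] [MeasurableSpace X]
    [MeasurableConstSMul G X] {μ : Measure X} [SMulInvariantMeasure G X μ] {s : Finset G}
    {V K : Set X} (h : s.card * μ V < μ K) : ∃ x ∈ K, ∀ g ∈ s, g • x ∉ V := by
  by_contra! hcover
  refine h.not_ge ?_
  calc μ K ≤ μ (⋃ g ∈ s, (g • ·) ⁻¹' V) := measure_mono fun x hx ↦ by simpa using hcover x hx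
    _ ≤ ∑ g ∈ s, μ ((g • ·) ⁻¹' V) := measure_biUnion_finset_le _ _
    _ = s.card * μ V := by simp [measure_preimage_smul]

lemma exists_forall_smul_notMem_explored {ι : Type*} [Fintype ι] {ρ : ι → ℝ≥0 → ℂ}
    (hρ : ∀ i, LipschitzWith 1 (ρ i)) (h0 : ∀ i, ρ i 0 = 0) {s : Finset Circle} {t : ℝ≥0} {r : ℝ}
    (hr : 0 ≤ r) (h : s.card * (Fintype.card ι * (max ((t : ℝ) - 1) 0 + 2 * π * r)) < 2 * π) :
    ∃ z : ℂ, ‖z‖ = 1 ∧ ∀ g ∈ s, ∀ i, g • z ∉ explored (ρ i) t r := by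
  set V : Set ℂ := ⋃ i, Metric.sphere 0 1 ∩ explored (ρ i) t r
  have hV : s.card * μH[1] V ≤
      ENNReal.ofReal (s.card * (Fintype.card ι * (max ((t : ℝ) - 1) 0 + 2 * π * r))) := by
    rw [ENNReal.ofReal_mul (by positivity), ENNReal.ofReal_natCast]
    gcongr
    calc μH[1] V ≤ ∑ i, μH[1] (Metric.sphere 0 1 ∩ explored (ρ i) t r) :=
          measure_iUnion_fintype_le _ _
      _ ≤ ∑ _i : ι, ENNReal.ofReal (max ((t : ℝ) - 1) 0 + 2 * π * r) :=
        Finset.sum_le_sum fun i _ ↦ hausdorffMeasure_sphere_inter_explored_le (hρ i) (h0 i) t hr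
      _ = _ := by simp [ENNReal.ofReal_mul]
  have hlt : s.card * μH[1] V < μH[1] (Metric.sphere (0 : ℂ) 1) :=
    (hV.trans_lt ((ENNReal.ofReal_lt_ofReal_iff two_pi_pos).2 h)).trans_le
      two_pi_le_hausdorffMeasure_sphere
  obtain ⟨z, hz, hzV⟩ := exists_mem_forall_smul_notMem hlt
  rw [mem_sphere_zero_iff_norm] at hz
  refine ⟨z, hz, fun g hg i hgz ↦ hzV g hg (mem_iUnion.2 ⟨i, ?_, hgz⟩)⟩
  rw [mem_sphere_zero_iff_norm, Circle.norm_smul, hz]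

lemma exists_pos_forall_exists_notMem_explored {t₀ : ℝ≥0} (ht₀ : t₀ < 1 + π / 3) :
    ∃ r : ℝ≥0, 0 < r ∧ ∀ ρ : Fin 2 → ℝ≥0 → ℂ, (∀ i, LipschitzWith 1 (ρ i)) → (∀ i, ρ i 0 = 0) →
      ∀ t ≤ t₀, ∀ s : Finset Circle, s.card ≤ 3 →
        ∃ z : ℂ, ‖z‖ = 1 ∧ ∀ g ∈ s, ∀ i, g • z ∉ explored (ρ i) t r := by
  set c : ℝ := max ((t₀ : ℝ) - 1) 0
  have hc : c < π / 3 := max_lt (by linarith) (by positivity)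
  have : 0 ≤ c := le_max_right _ _
  obtain ⟨r, hr⟩ : ∃ r : ℝ≥0, (r : ℝ) = (π / 3 - c) / (4 * π) :=
    CanLift.prf _ (div_nonneg (by linarith) (by positivity))
  have hr0 : 0 < r := by
    rw [← NNReal.coe_pos, hr]
    exact div_pos (by linarith) (by positivity)
  refine ⟨r, hr0, fun ρ hρ h0 t ht s hs ↦
    exists_forall_smul_notMem_explored hρ h0 r.coe_nonneg ?_⟩
  calc _ ≤ 3 * (2 * (c + 2 * π * r)) := by
        rw [Fintype.card_fin, Nat.cast_two]
        gcongr
        · exact_mod_cast hs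
        · exact max_le_max_right 0 (by gcongr)
    _ = 3 * c + π := by rw [hr]; field_simp; ring
    _ < 2 * π := by linarith

/-! ### Runs in which nothing has been discovered -/

lemma eventually_forall_mem_Icc {X : Type*} [TopologicalSpace X] [LinearOrder X] [OrderTopology X]
    {p : X → Prop} {x : X} (h : ∀ᶠ y in 𝓝 x, p y) : ∀ᶠ y in 𝓝 x, ∀ z ∈ Icc x y, p z :=
  (tendsto_const_nhds.Icc tendsto_id).eventually h.smallSets

lemma le_induction_of_isClosed {X : Type*} [ConditionallyCompleteLinearOrder X] [OrderBot X]
    [DenselyOrdered X] [TopologicalSpace X] [OrderTopology X] {p : X → Prop} {t : X}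
    (hclosed : IsClosed {s | p s}) (hbot : p ⊥)
    (hright : ∀ s < t, (∀ u ≤ s, p u) → ∀ᶠ u in 𝓝[>] s, p u) : ∀ s ≤ t, p s := by
  have hsub : Icc ⊥ t ⊆ {s | p s} :=
    (hclosed.inter isClosed_Icc).Icc_subset_of_forall_mem_nhdsGT_of_Icc_subset hbot
      fun s hs hp ↦ hright s hs.2 fun u hu ↦ hp ⟨bot_le, hu⟩
  exact fun s hs ↦ hsub ⟨bot_le, hs⟩

/-- The two points where a robot can discover something. -/
def Placement.sites {α : ℝ} (P : Placement α) : Set ℂ := {P.treasure, P.exit}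

lemma Placement.finite_sites {α : ℝ} (P : Placement α) : P.sites.Finite :=
  Set.toFinite {P.treasure, P.exit}

lemma Placement.norm_eq_one_of_mem_sites {α : ℝ} {P : Placement α} {v : ℂ}
    (hv : v ∈ P.sites) : ‖v‖ = 1 := by
  rcases hv with rfl | rfl
  exacts [P.norm_treasure, P.norm_exit]

lemma Differs.robot_induction {α : ℝ} {B : Behaviour α} {P Q : Placement α}
    {R : Fin 2 → ℝ≥0 → Prop} {t : ℝ≥0}
    (exit : ∀ i, ∀ s ≤ t, B.robot P i s = P.exit ∨ B.robot Q i s = Q.exit → R i s)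
    (treasure : ∀ i, ∀ s ≤ t, B.treasure P s ≠ B.treasure Q s →
      B.robot P i s = B.treasure P s ∨ B.robot Q i s = B.treasure Q s → R i s)
    (meet : ∀ i j, ∀ s ≤ t, R j s →
      B.robot P i s = B.robot P j s ∨ B.robot Q i s = B.robot Q j s → R i s)
    (mono : ∀ i s u, s ≤ u → R i s → R i u)
    {i : Fin 2} {s : ℝ≥0} (hs : s ≤ t) (h : Differs B P Q (.robot i) s) : R i s := by
  generalize hb : Body.robot i = b at h
  induction h generalizing i with
  | seeExit j s _ hvisit =>
    cases hb
    exact exit j s hs hvisit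
  | seeTreasure j s _ hne hvisit =>
    cases hb
    exact treasure j s hs hne hvisit
  | meet j k s _ hmeet ih =>
    cases hb
    exact meet j k s hs (ih hs rfl) hmeet
  | remember j s u hsu _ ih =>
    cases hb
    exact mono j s u hsu (ih (hsu.trans hs) rfl)
  | hidden | handle | apart => cases hb

namespace F2FAlgorithm

variable {α : ℝ} {A : F2FAlgorithm α} {P Q : Placement α}

lemma continuous_robot (A : F2FAlgorithm α) (P : Placement α) (i : Fin 2) :
    Continuous (A.robot P i) :=
  (A.robot_speed P i).continuous

lemma treasure_eq_of_unvisited {t : ℝ≥0} (h : ∀ s < t, ∀ i, A.robot P i s ≠ P.treasure) :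
    A.treasure P t = P.treasure := by
  have hcont : Continuous (A.treasure P) := (A.treasure_speed P).continuous
  refine le_induction_of_isClosed (isClosed_eq hcont continuous_const) (A.treasure_zero P)
    (fun s hst hrest ↦ ?_) t le_rfl
  have hTs : A.treasure P s = P.treasure := hrest s le_rfl
  have halone : ∀ᶠ u in 𝓝 s, ∀ i, A.robot P i u ≠ A.treasure P u :=
    eventually_all.2 fun i ↦
      (isOpen_ne_fun (A.continuous_robot P i) hcont).mem_nhds <| by
        simpa only [mem_ofPred_eq, hTs] using h s hst i
  filter_upwards [nhdsWithin_le_nhds (eventually_forall_mem_Icc halone), self_mem_nhdsWithin]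
    with u halone_u hsu
  rw [← hTs]
  exact (A.treasure_rest P s u hsu.le fun v hsv hvu ↦ halone_u v ⟨hsv, hvu⟩).symm

/-- Under the placement `P`, no robot has been at a site up to time `t` (inclusive). -/
def Undiscovered (A : F2FAlgorithm α) (P : Placement α) (t : ℝ≥0) : Prop :=
  ∀ s ≤ t, ∀ i, A.robot P i s ∉ P.sites

lemma Undiscovered.mono {s t : ℝ≥0} (h : A.Undiscovered P t) (hst : s ≤ t) :
    A.Undiscovered P s :=
  fun u hu ↦ h u (hu.trans hst)

lemma undiscovered_zero (A : F2FAlgorithm α) (P : Placement α) : A.Undiscovered P 0 := by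
  intro s hs i hmem
  have hnorm := P.norm_eq_one_of_mem_sites hmem
  rw [nonpos_iff_eq_zero.1 hs, A.robot_zero, norm_zero] at hnorm
  exact zero_ne_one hnorm

namespace Undiscovered

variable {i : Fin 2} {s t t₀ : ℝ≥0}

lemma treasure_eq (h : A.Undiscovered P t) (hst : s ≤ t) : A.treasure P s = P.treasure :=
  treasure_eq_of_unvisited fun u hu i hvisit ↦ h u (hu.le.trans hst) i (.inl hvisit)

lemma lt_of_mem_sites (h : A.Undiscovered P t₀) (hmem : A.robot P i t ∈ P.sites) : t₀ < t := by
  by_contra! ht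
  exact h t ht i hmem

lemma le_of_robot_eq_treasure (h : A.Undiscovered P t₀) (heq : A.robot P i t = A.treasure P t) :
    t₀ ≤ t := by
  by_contra! ht
  rw [h.treasure_eq ht.le] at heq
  exact h t ht.le i (.inl heq)

lemma not_differs (hP : A.Undiscovered P t) (hQ : A.Undiscovered Q t) :
    ¬ Differs A.toBehaviour P Q (.robot i) t := by
  refine Differs.robot_induction (R := fun _ _ ↦ False) (t := t) ?_ ?_ ?_ ?_ le_rfl
  · rintro i s hs (h | h)
    exacts [hP s hs i (.inr h), hQ s hs i (.inr h)]
  · rintro i s hs - (h | h)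
    · exact hP s hs i (.inl (h.trans (hP.treasure_eq hs)))
    · exact hQ s hs i (.inl (h.trans (hQ.treasure_eq hs)))
  · exact fun _ _ _ _ h _ ↦ h
  · exact fun _ _ _ _ h ↦ h

lemma robot_eq (hP : A.Undiscovered P t) (hQ : A.Undiscovered Q t) (i : Fin 2) :
    A.robot P i t = A.robot Q i t :=
  A.robot_causal P Q i t (hP.not_differs hQ)

lemma of_unvisited (hP : A.Undiscovered P t) (h : ∀ s ≤ t, ∀ i, A.robot P i s ∉ Q.sites) :
    A.Undiscovered Q t := by
  suffices hsame : ∀ s ≤ t, ∀ i, A.robot Q i s = A.robot P i s by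
    intro s hs i
    rw [hsame s hs i]
    exact h s hs i
  have hclosed : IsClosed {s | ∀ i, A.robot Q i s = A.robot P i s} := by
    simp only [ofPred_forall]
    exact isClosed_iInter fun i ↦ isClosed_eq (A.continuous_robot Q i) (A.continuous_robot P i)
  refine le_induction_of_isClosed hclosed (fun i ↦ by rw [bot_eq_zero, A.robot_zero, A.robot_zero])
    fun s hst hsame ↦ ?_
  have haway : ∀ᶠ u in 𝓝 s, ∀ i, A.robot Q i u ∉ Q.sites :=
    eventually_all.2 fun i ↦ (A.continuous_robot Q i).continuousAt.eventually <|
      Q.finite_sites.isClosed.isOpen_compl.mem_nhds <| by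
        rw [mem_compl_iff, hsame s le_rfl i]
        exact h s hst.le i
  filter_upwards [nhdsWithin_le_nhds (eventually_forall_mem_Icc haway),
    nhdsWithin_le_nhds (Iio_mem_nhds hst)] with u haway_u hut i
  refine robot_eq (fun v hv j ↦ ?_) (hP.mono hut.le) i
  rcases le_total v s with hvs | hsv
  · rw [hsame v hvs j]
    exact h v (hvs.trans hst.le) j
  · exact haway_u v ⟨hsv, hv⟩ j

end Undiscovered

end F2FAlgorithm

/-! ### Light cones -/

lemma isClosed_ofPred_exists_mem {X ι : Type*} [TopologicalSpace X] {s : Set ι} (hs : s.Finite)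
    {p : ι → X → Prop} (h : ∀ v ∈ s, IsClosed {x | p v x}) : IsClosed {x | ∃ v ∈ s, p v x} := by
  convert! hs.isClosed_biUnion h
  ext x
  simp

/-- The points that a signal sent from `v` at time `t₀` can have reached by time `t` if it travels
at speed at most `1`; no point at all if `t < t₀`. -/
def lightCone {E : Type*} [PseudoMetricSpace E] (t₀ : ℝ≥0) (v : E) (t : ℝ≥0) : Set E :=
  Metric.closedBall v (t - t₀)

lemma mem_lightCone_mono {E : Type*} [PseudoMetricSpace E] {γ : ℝ≥0 → E} (hγ : LipschitzWith 1 γ)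
    {t₀ s t : ℝ≥0} {v : E} (hst : s ≤ t) (h : γ s ∈ lightCone t₀ v s) : γ t ∈ lightCone t₀ v t := by
  rw [lightCone, Metric.mem_closedBall] at h ⊢
  linarith [dist_triangle (γ t) (γ s) v, dist_le_sub hγ hst]

lemma isClosed_ofPred_mem_lightCone {E : Type*} [PseudoMetricSpace E] {γ : ℝ≥0 → E}
    (hγ : Continuous γ) (t₀ : ℝ≥0) (v : E) : IsClosed {t | γ t ∈ lightCone t₀ v t} :=
  isClosed_le (hγ.dist continuous_const) (by fun_prop)

namespace F2FAlgorithm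

variable {α : ℝ} {A : F2FAlgorithm α} {P Q : Placement α} {t₀ s t : ℝ≥0} {i : Fin 2}

lemma Undiscovered.robot_mem_lightCone_exit (h : A.Undiscovered P t₀)
    (heq : A.robot P i t = P.exit) : A.robot P i t ∈ lightCone t₀ P.exit t := by
  have ht : t₀ < t := h.lt_of_mem_sites (.inr heq)
  rw [heq]
  exact Metric.mem_closedBall_self (sub_nonneg.2 ht.le)

lemma Undiscovered.robot_mem_lightCone_treasure (h : A.Undiscovered P t₀)
    (heq : A.robot P i t = A.treasure P t) : A.robot P i t ∈ lightCone t₀ P.treasure t := by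
  rw [heq, ← h.treasure_eq le_rfl]
  exact dist_le_sub (A.treasure_speed P) (h.le_of_robot_eq_treasure heq)

/-- Under at least one of the placements `P` and `Q`, robot `i` can at time `t` have been reached by
a signal sent at time `t₀` from a site of `P` or `Q`. -/
def InSomeCone (A : F2FAlgorithm α) (P Q : Placement α) (t₀ : ℝ≥0) (i : Fin 2) (t : ℝ≥0) : Prop :=
  ∃ v ∈ P.sites ∪ Q.sites, A.robot P i t ∈ lightCone t₀ v t ∨ A.robot Q i t ∈ lightCone t₀ v t

/-- Under both placements `P` and `Q`, robot `i` can at time `t` have been reached by a signal sent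
at time `t₀` from one and the same site of `P` or `Q`. -/
def InCommonCone (A : F2FAlgorithm α) (P Q : Placement α) (t₀ : ℝ≥0) (i : Fin 2) (t : ℝ≥0) : Prop :=
  ∃ v ∈ P.sites ∪ Q.sites, A.robot P i t ∈ lightCone t₀ v t ∧ A.robot Q i t ∈ lightCone t₀ v t

lemma InCommonCone.mono (h : A.InCommonCone P Q t₀ i s) (hst : s ≤ t) :
    A.InCommonCone P Q t₀ i t :=
  let ⟨v, hv, hP, hQ⟩ := h
  ⟨v, hv, mem_lightCone_mono (A.robot_speed P i) hst hP,
    mem_lightCone_mono (A.robot_speed Q i) hst hQ⟩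

lemma InSomeCone.inCommonCone_of_robot_eq (h : A.InSomeCone P Q t₀ i t)
    (heq : A.robot P i t = A.robot Q i t) : A.InCommonCone P Q t₀ i t := by
  simpa only [InSomeCone, InCommonCone, heq, or_self, and_self] using h

lemma isClosed_ofPred_inSomeCone (A : F2FAlgorithm α) (P Q : Placement α) (t₀ : ℝ≥0) (i : Fin 2) :
    IsClosed {t | A.InSomeCone P Q t₀ i t} :=
  isClosed_ofPred_exists_mem (P.finite_sites.union Q.finite_sites) fun v _ ↦
    (isClosed_ofPred_mem_lightCone (A.continuous_robot P i) t₀ v).union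
      (isClosed_ofPred_mem_lightCone (A.continuous_robot Q i) t₀ v)

lemma isClosed_ofPred_inCommonCone (A : F2FAlgorithm α) (P Q : Placement α) (t₀ : ℝ≥0)
    (i : Fin 2) : IsClosed {t | A.InCommonCone P Q t₀ i t} :=
  isClosed_ofPred_exists_mem (P.finite_sites.union Q.finite_sites) fun v _ ↦
    (isClosed_ofPred_mem_lightCone (A.continuous_robot P i) t₀ v).inter
      (isClosed_ofPred_mem_lightCone (A.continuous_robot Q i) t₀ v)

lemma inCommonCone_of_differs (hP : A.Undiscovered P t₀) (hQ : A.Undiscovered Q t₀)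
    (hcone : ∀ s ≤ t, ∀ i, A.InSomeCone P Q t₀ i s → A.InCommonCone P Q t₀ i s)
    (h : Differs A.toBehaviour P Q (.robot i) t) : A.InCommonCone P Q t₀ i t := by
  refine Differs.robot_induction (t := t) (R := A.InCommonCone P Q t₀) ?_ ?_ ?_
    (fun _ _ _ hsu hs ↦ hs.mono hsu) le_rfl h
  · rintro i s hs (h | h)
    · exact hcone s hs i ⟨P.exit, .inl (.inr rfl), .inl (hP.robot_mem_lightCone_exit h)⟩
    · exact hcone s hs i ⟨Q.exit, .inr (.inr rfl), .inr (hQ.robot_mem_lightCone_exit h)⟩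
  · rintro i s hs - (h | h)
    · exact hcone s hs i ⟨P.treasure, .inl (.inl rfl), .inl (hP.robot_mem_lightCone_treasure h)⟩
    · exact hcone s hs i ⟨Q.treasure, .inr (.inl rfl), .inr (hQ.robot_mem_lightCone_treasure h)⟩
  · rintro i j s hs ⟨v, hv, hPj, hQj⟩ (h | h)
    · exact hcone s hs i ⟨v, hv, .inl (h ▸ hPj)⟩
    · exact hcone s hs i ⟨v, hv, .inr (h ▸ hQj)⟩

lemma robot_eq_or_inCommonCone (hP : A.Undiscovered P t₀) (hQ : A.Undiscovered Q t₀) (t : ℝ≥0)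
    (i : Fin 2) : A.robot P i t = A.robot Q i t ∨ A.InCommonCone P Q t₀ i t := by
  have hclosed :
      IsClosed {s | ∀ i, A.robot P i s = A.robot Q i s ∨ A.InCommonCone P Q t₀ i s} := by
    simp only [ofPred_forall]
    exact isClosed_iInter fun i ↦
      (isClosed_eq (A.continuous_robot P i) (A.continuous_robot Q i)).union
        (A.isClosed_ofPred_inCommonCone P Q t₀ i)
  refine le_induction_of_isClosed hclosed
    (fun i ↦ .inl (by rw [bot_eq_zero, A.robot_zero, A.robot_zero])) (fun s _ hbefore ↦ ?_)
    t le_rfl i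
  have hcone : ∀ u ≤ s, ∀ i, A.InSomeCone P Q t₀ i u → A.InCommonCone P Q t₀ i u := fun u hu i h ↦
    (hbefore u hu i).elim h.inCommonCone_of_robot_eq id
  have hnear : ∀ᶠ u in 𝓝 s, ∀ i, ¬ A.InCommonCone P Q t₀ i s → ¬ A.InSomeCone P Q t₀ i u :=
    eventually_all.2 fun i ↦ eventually_imp_distrib_left.2 fun hi ↦
      (A.isClosed_ofPred_inSomeCone P Q t₀ i).isOpen_compl.mem_nhds (hi ∘ hcone s le_rfl i)
  filter_upwards [nhdsWithin_le_nhds (eventually_forall_mem_Icc hnear)] with u hnear_u i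
  by_cases hdiff : Differs A.toBehaviour P Q (.robot i) u
  · refine .inr (inCommonCone_of_differs hP hQ (fun v hv j hj ↦ ?_) hdiff)
    rcases le_total v s with hvs | hsv
    · exact hcone v hvs j hj
    · exact (not_imp_not.1 (hnear_u v ⟨hsv, hv⟩ j) hj).mono hsv
  · exact .inl (A.robot_causal P Q i u hdiff)

end F2FAlgorithm

/-! ### Placements on successive points of the circle -/

namespace Placement

variable {α : ℝ}

lemma norm_treasure_sub_exit (P : Placement α) : ‖P.treasure - P.exit‖ = 2 * sin (α / 2) := by
  have hsin : 0 ≤ sin (α / 2) := by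
    rw [← P.arc]
    exact sin_nonneg_of_nonneg_of_le_pi
      (by linarith [InnerProductGeometry.angle_nonneg P.treasure P.exit])
      (by linarith [InnerProductGeometry.angle_le_pi P.treasure P.exit, pi_pos])
  have hcos : cos α = 1 - 2 * sin (α / 2) ^ 2 := by
    rw [← cos_two_mul_eq_one_sub, mul_div_cancel₀ _ two_ne_zero]
  rw [← sq_eq_sq₀ (norm_nonneg _) (by positivity), norm_sub_sq_real,
    InnerProductGeometry.inner_eq_cos_angle_of_norm_eq_one P.norm_treasure P.norm_exit, P.arc,
    P.norm_treasure, P.norm_exit, hcos]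
  ring

/-- The placement with treasure and exit interchanged. -/
@[simps]
def swap (P : Placement α) : Placement α where
  treasure := P.exit
  exit := P.treasure
  norm_treasure := P.norm_exit
  norm_exit := P.norm_treasure
  arc := by rw [InnerProductGeometry.angle_comm, P.arc]

end Placement

lemma angle_circleExp_smul {α : ℝ} (h0 : 0 ≤ α) (hπ : α ≤ π) {z : ℂ} (hz : z ≠ 0) :
    InnerProductGeometry.angle z (Circle.exp α • z) = α := by
  rw [InnerProductGeometry.angle_comm, Circle.smul_def, smul_eq_mul,
    Complex.angle_eq_abs_arg (by simp [hz]) hz, mul_div_cancel_right₀ _ hz,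
    Circle.arg_exp (by linarith [pi_pos]) hπ, abs_of_nonneg h0]

/-- The placement with the treasure at `z` and the exit at angle `α` counterclockwise from it. -/
@[simps]
noncomputable def Placement.ofTreasure {α : ℝ} (h0 : 0 ≤ α) (hπ : α ≤ π) (z : ℂ) (hz : ‖z‖ = 1) :
    Placement α where
  treasure := z
  exit := Circle.exp α • z
  norm_treasure := hz
  norm_exit := by rw [Circle.norm_smul, hz]
  arc := angle_circleExp_smul h0 hπ (norm_ne_zero_iff.1 (by simp [hz]))

/-- Three placements, with treasures at three points at successive arc distance `α`; in each of them
the exit is at one of the same three points. -/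
noncomputable def Placement.triple {α : ℝ} (h0 : 0 ≤ α) (hπ : α ≤ π) (z : ℂ) (hz : ‖z‖ = 1) :
    Fin 3 → Placement α :=
  ![ofTreasure h0 hπ z hz, (ofTreasure h0 hπ z hz).swap,
    (ofTreasure h0 hπ (Circle.exp α • z) (by rw [Circle.norm_smul, hz])).swap]

namespace Placement

variable {α : ℝ} (h0 : 0 ≤ α) (hπ : α ≤ π) {z : ℂ} (hz : ‖z‖ = 1)

lemma triple_treasure (k : Fin 3) :
    (triple h0 hπ z hz k).treasure = Circle.exp (k * α) • z := by
  fin_cases k <;> simp [triple, smul_smul, ← Circle.exp_add, two_mul]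

lemma exists_triple_exit_eq_treasure (k : Fin 3) :
    ∃ l, (triple h0 hπ z hz k).exit = (triple h0 hπ z hz l).treasure := by
  fin_cases k
  exacts [⟨1, rfl⟩, ⟨0, rfl⟩, ⟨1, rfl⟩]

lemma le_dist_triple_treasure {k l : Fin 3} (hkl : k ≠ l) :
    2 * min (sin (α / 2)) (sin α) ≤
      dist (triple h0 hπ z hz k).treasure (triple h0 hπ z hz l).treasure := by
  wlog hlt : l < k generalizing k l
  · rw [dist_comm]
    exact this hkl.symm (hkl.lt_or_gt.resolve_right hlt)
  rw [triple_treasure, triple_treasure, dist_circleExp_smul, hz, mul_one]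
  gcongr
  obtain h | h :
      ((k : ℕ) : ℝ) * α - (l : ℕ) * α = α ∨ ((k : ℕ) : ℝ) * α - (l : ℕ) * α = 2 * α := by
    fin_cases k <;> fin_cases l <;> simp_all [two_mul]
  · rw [h]
    exact (min_le_left _ _).trans (le_abs_self _)
  · rw [h, mul_div_cancel_left₀ _ two_ne_zero]
    exact (min_le_right _ _).trans (le_abs_self _)

end Placement

/-! ### The adversary -/

namespace F2FAlgorithm

variable {α : ℝ} {A : F2FAlgorithm α} {P Q : Placement α}

lemma Undiscovered.of_notMem_explored {t r : ℝ≥0} (hP : A.Undiscovered P t)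
    (h : ∀ v ∈ Q.sites, ∀ i, v ∉ explored (A.robot P i) t r) : A.Undiscovered Q (t + r) := by
  have hQ : A.Undiscovered Q t :=
    hP.of_unvisited fun s hs i hmem ↦ h _ hmem i (.inl ⟨s, hs, rfl⟩)
  intro s hs i hmem
  have hts : t < s := hQ.lt_of_mem_sites hmem
  refine h _ hmem i (.inr ?_)
  rw [Metric.mem_closedBall, hP.robot_eq hQ]
  have hsr : (s : ℝ) ≤ t + r := by exact_mod_cast hs
  linarith [hsr, dist_le_sub (A.robot_speed Q i) hts.le]

lemma exists_undiscovered (A : F2FAlgorithm α) (h0 : 0 ≤ α) (hπ : α ≤ π) {t₀ : ℝ≥0}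
    (ht₀ : t₀ < 1 + π / 3) : ∃ P, A.Undiscovered P t₀ := by
  classical
  obtain ⟨r, hr, hfree⟩ := exists_pos_forall_exists_notMem_explored ht₀
  -- Repeatedly move treasure and exit to where no robot can be within the next `r` units of time.
  have hstep : ∀ P, ∀ s ≤ t₀, A.Undiscovered P s → ∃ Q, A.Undiscovered Q (s + r) := by
    intro P s hs hP
    obtain ⟨z, hz, hzfree⟩ := hfree (A.robot P) (A.robot_speed P) (A.robot_zero P) s hs
      {1, Circle.exp α} (Finset.card_le_two.trans (by norm_num))
    refine ⟨.ofTreasure h0 hπ z hz, hP.of_notMem_explored ?_⟩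
    rintro v (rfl | rfl)
    · simpa using hzfree 1 (by simp)
    · exact hzfree (Circle.exp α) (by simp)
  have hmin : ∀ n : ℕ, ∃ P, A.Undiscovered P (min (n • r) t₀) := by
    intro n
    induction n with
    | zero => exact ⟨.ofTreasure h0 hπ 1 norm_one, by simpa using A.undiscovered_zero _⟩
    | succ n ih =>
      obtain ⟨P, hP⟩ := ih
      obtain ⟨Q, hQ⟩ := hstep P _ (min_le_right _ _) hP
      refine ⟨Q, hQ.mono ?_⟩
      rw [succ_nsmul, min_add]
      exact min_le_min_left _ le_self_add
  obtain ⟨n, hn⟩ := Archimedean.arch t₀ hr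
  simpa only [min_eq_right hn] using hmin n

lemma add_le_of_visits {t₀ s t : ℝ≥0} {i : Fin 2} {m : ℝ} (hP : A.Undiscovered P t₀)
    (hQ : A.Undiscovered Q t₀) (hPs : A.robot P i s = P.treasure) (hQt : A.robot Q i t = Q.treasure)
    (hst : s ≤ t) (htreasure : m ≤ dist P.treasure Q.treasure)
    (hsites : ∀ v ∈ P.sites ∪ Q.sites, v = P.treasure ∨ m ≤ dist P.treasure v) : t₀ + m ≤ t := by
  have hts : (s : ℝ) ≤ t := hst
  rcases robot_eq_or_inCommonCone hP hQ s i with heq | ⟨v, hv, hPv, hQv⟩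
  · have ht₀s : (t₀ : ℝ) < s := hP.lt_of_mem_sites (.inl hPs)
    have hdist := dist_le_sub (A.robot_speed Q i) hst
    rw [hQt, ← heq, hPs, dist_comm] at hdist
    linarith
  · rcases hsites v hv with rfl | hfar
    · have hQT := mem_lightCone_mono (A.robot_speed Q i) hst hQv
      rw [hQt, lightCone, Metric.mem_closedBall, dist_comm] at hQT
      linarith [hts]
    · rw [hPs, lightCone, Metric.mem_closedBall] at hPv
      linarith [hts]

lemma exists_forall_visit_le {κ : Type*} [Fintype κ] (hκ : 2 < Fintype.card κ)
    {P : κ → Placement α} {t₀ : ℝ≥0} {m : ℝ} (hP : ∀ k, A.Undiscovered (P k) t₀)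
    (hexit : ∀ k, ∃ l, (P k).exit = (P l).treasure)
    (hdist : ∀ k l, k ≠ l → m ≤ dist (P k).treasure (P l).treasure) :
    ∃ k, ∀ i (s : ℝ≥0), A.robot (P k) i s = (P k).treasure → t₀ + m ≤ s := by
  by_contra! hearly
  choose i s hvisit hs using hearly
  have hsites : ∀ k l, ∀ v ∈ (P k).sites ∪ (P l).sites,
      v = (P k).treasure ∨ m ≤ dist (P k).treasure v := by
    intro k l v hv
    obtain ⟨j, rfl⟩ : ∃ j, v = (P j).treasure := by
      rcases hv with (rfl | rfl) | (rfl | rfl)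
      exacts [⟨k, rfl⟩, hexit k, ⟨l, rfl⟩, hexit l]
    rcases eq_or_ne j k with rfl | hjk
    exacts [.inl rfl, .inr (hdist k j hjk.symm)]
  obtain ⟨k, l, hkl, hikl⟩ := Fintype.exists_ne_map_eq_of_card_lt i (by simpa using hκ)
  wlog hskl : s k ≤ s l generalizing k l
  · exact this l k hkl.symm hikl.symm (le_of_not_ge hskl)
  exact (hs l).not_ge <| add_le_of_visits (hP k) (hP l) (hvisit k) (hikl ▸ hvisit l) hskl
    (hdist k l hkl) (hsites k l)

lemma ofReal_le_evacuationTime {c : ℝ} (h : ∀ i (s : ℝ≥0), A.robot P i s = P.treasure → c ≤ s) :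
    ENNReal.ofReal (c + 2 * sin (α / 2)) ≤ A.evacuationTime P := by
  refine le_iInf₂ fun t ⟨htreasure, i, hrobot⟩ ↦ ENNReal.ofReal_le_of_le_toReal ?_
  rw [ENNReal.coe_toReal, ← P.norm_treasure_sub_exit]
  have hct : c ≤ t := by
    by_contra! htc
    have hrest : A.treasure P t = P.treasure := treasure_eq_of_unvisited fun u hu i hvisit ↦
      (h i u hvisit).not_gt ((NNReal.coe_lt_coe.2 hu).trans htc)
    exact (h i t (by rw [hrobot, ← htreasure, hrest])).not_gt htc
  have hrest : A.treasure P c.toNNReal = P.treasure := treasure_eq_of_unvisited fun u hu i hvisit ↦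
    (h i u hvisit).not_gt (lt_toNNReal_iff_coe_lt.1 hu)
  have hcarry := dist_le_sub (A.treasure_speed P) (toNNReal_le_iff_le_coe.2 hct)
  rw [htreasure, hrest, dist_comm, dist_eq_norm] at hcarry
  linarith [le_coe_toNNReal c]

lemma le_worstCaseTime_of_lt (A : F2FAlgorithm α) (h0 : 0 ≤ α) (hπ : α ≤ π) {t₀ : ℝ≥0}
    (ht₀ : t₀ < 1 + π / 3) :
    ENNReal.ofReal (t₀ + 2 * min (sin (α / 2)) (sin α) + 2 * sin (α / 2)) ≤ A.worstCaseTime := by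
  classical
  obtain ⟨P₀, hP₀⟩ := A.exists_undiscovered h0 hπ ht₀
  obtain ⟨r, -, hfree⟩ := exists_pos_forall_exists_notMem_explored ht₀
  obtain ⟨z, hz, hzfree⟩ := hfree (A.robot P₀) (A.robot_speed P₀) (A.robot_zero P₀) t₀ le_rfl
    (Finset.univ.image fun k : Fin 3 ↦ Circle.exp (k * α)) Finset.card_image_le
  set P := Placement.triple h0 hπ z hz
  have hunvisited : ∀ k, ∀ s ≤ t₀, ∀ i, A.robot P₀ i s ≠ (P k).treasure := by
    intro k s hs i hvisit
    rw [Placement.triple_treasure] at hvisit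
    exact hzfree _ (Finset.mem_image_of_mem _ (Finset.mem_univ k)) i (.inl ⟨s, hs, hvisit⟩)
  have hP : ∀ k, A.Undiscovered (P k) t₀ := by
    refine fun k ↦ hP₀.of_unvisited fun s hs i ↦ ?_
    obtain ⟨l, hl⟩ := Placement.exists_triple_exit_eq_treasure h0 hπ hz k
    rintro (hvisit | hvisit)
    exacts [hunvisited k s hs i hvisit, hunvisited l s hs i (hvisit.trans hl)]
  obtain ⟨k, hk⟩ := exists_forall_visit_le (by simp) hP
    (Placement.exists_triple_exit_eq_treasure h0 hπ hz)
    fun _ _ ↦ Placement.le_dist_triple_treasure h0 hπ hz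
  exact (ofReal_le_evacuationTime hk).trans (le_iSup A.evacuationTime (P k))

lemma le_worstCaseTime (A : F2FAlgorithm α) (h0 : 0 ≤ α) (hπ : α ≤ π) :
    ENNReal.ofReal (1 + π / 3 + 2 * min (sin (α / 2)) (sin α) + 2 * sin (α / 2)) ≤
      A.worstCaseTime := by
  have hcont : Continuous fun t ↦
      ENNReal.ofReal (t + 2 * min (sin (α / 2)) (sin α) + 2 * sin (α / 2)) :=
    ENNReal.continuous_ofReal.comp (by fun_prop)
  have hpos : 0 < 1 + π / 3 := by positivity
  refine le_of_tendsto (hcont.continuousWithinAt (s := Iio (1 + π / 3))) ?_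
  filter_upwards [Ioo_mem_nhdsLT hpos] with t ht
  lift t to ℝ≥0 using ht.1.le
  exact A.le_worstCaseTime_of_lt h0 hπ ht.2

end F2FAlgorithm

lemma sin_half_le_sin {x : ℝ} (h0 : 0 ≤ x) (h : x ≤ 2 * π / 3) : sin (x / 2) ≤ sin x := by
  have hsin : 0 ≤ sin ((x - x / 2) / 2) :=
    sin_nonneg_of_nonneg_of_le_pi (by linarith) (by linarith)
  have hcos : 0 ≤ cos ((x + x / 2) / 2) :=
    cos_nonneg_of_neg_pi_div_two_le_of_le (by linarith [pi_pos]) (by linarith)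
  rw [← sub_nonneg, sin_sub_sin]
  positivity

lemma sin_le_sin_half {x : ℝ} (h : 2 * π / 3 ≤ x) (h2π : x ≤ 2 * π) : sin x ≤ sin (x / 2) := by
  have hsin : 0 ≤ sin ((x - x / 2) / 2) :=
    sin_nonneg_of_nonneg_of_le_pi (by linarith [pi_pos]) (by linarith)
  have hcos : cos ((x + x / 2) / 2) ≤ 0 :=
    cos_nonpos_of_pi_div_two_le_of_le (by linarith) (by linarith)
  rw [← sub_nonpos, sin_sub_sin]
  exact mul_nonpos_of_nonneg_of_nonpos (by positivity) hcos

end TreasureEvacuation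

theorem mainTheorem3 (α : ℝ) (A : TreasureEvacuation.F2FAlgorithm α) :
    (0 ≤ α → α ≤ 2 * Real.pi / 3 →
      ENNReal.ofReal (1 + Real.pi / 3 + 4 * Real.sin (α / 2)) ≤ A.worstCaseTime) ∧
    (2 * Real.pi / 3 ≤ α → α ≤ Real.pi →
      ENNReal.ofReal (1 + Real.pi / 3 + 2 * Real.sin α + 2 * Real.sin (α / 2)) ≤
        A.worstCaseTime) := by
  have hpi := Real.pi_pos
  refine ⟨fun h0 h ↦ ?_, fun h hπ ↦ ?_⟩
  · have hbound := A.le_worstCaseTime h0 (by linarith)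
    rw [min_eq_left (TreasureEvacuation.sin_half_le_sin h0 h)] at hbound
    convert! hbound using 2
    ring
  · have hbound := A.le_worstCaseTime (by linarith) hπ
    rwa [min_eq_right (TreasureEvacuation.sin_le_sin_half h (by linarith))] at hbound
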